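/- For random variables $X,Y$ and a class $\mathcal H$ of functions $\mathbb R\to\mathbb R$ let $d_{\mathcal H}(X,Y)=\sup_{h\in\mathcal H}|\mathbb E h(X)-\mathbb E h(Y)|$. The Wasserstein distance $d$ is $d_{\mathcal H}$ with $\mathcal H=\{h:|h(x)-h(y)|\le|x-y|\text{ for all }x,y\in\mathbb R\}$, and the Kolmogorov distance $d_K$ is $d_{\mathcal H}$ with $\mathcal H=\{\mathbf 1_{(-\infty,z]}:z\in\mathbb R\}$. Let $Z$ be a standard normal random variable. Let $W$ be a real random variable with mean $0$ and variance $1$, and let $(W'',W',G)$ be a triple of real random variables on the same probability space that is a zbest coupling for $W$, that is, $$\mathbb E[Wf(W)]=\mathbb E[G(f(W'')-f(W'))]$$ for all smooth (infinitely differentiable) functions $f:\mathbb R\to\mathbb R$ for which both expectations exist, where the expectations are supposed to exist at least for all smooth $f$ with compact support. Let $U$ be uniformly distributed on $[0,1]$ and independent of $(W'',W',G)$ (but not necessarily of $W$), and put $D=W''-W'$ and $W^*=UW''+(1-U)W'$. Then, where expectations of nonnegative variables may be $+\infty$, $$d(W,Z)\le 2\,\mathbb E|W^*-W|+\sqrt{2/\pi}\;\mathbb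 E|1-GD|,$$ and, if $|W^*-W|\le\delta$ almost surely for some $\delta\ge 0$, $$d_K(W,Z)\le\left(\frac1{\sqrt{2\pi}}+\frac{\sqrt{2\pi}}4+1\right)\delta+\mathbb E|1-GD|,$$ where the constant multiplying $\delta$ is less than $2.03$. -/

import Mathlib

open MeasureTheory ProbabilityTheory
open scoped ENNReal

/-- The distance `sup_{h ∈ H} |∫ h dμ - ∫ h dν|` between two laws on `ℝ` induced by a class `H`
of test functions, as an extended nonnegative real. -/
noncomputable def testDist (H : Set (ℝ → ℝ)) (μ ν : Measure ℝ) : ℝ≥0∞ :=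
  ⨆ h ∈ H, ENNReal.ofReal |∫ x, h x ∂μ - ∫ x, h x ∂ν|

/-- The functions `h : ℝ → ℝ` with `|h x - h y| ≤ |x - y|`. -/
def lipOne : Set (ℝ → ℝ) := {h | LipschitzWith 1 h}

/-- The indicators of the half lines `(-∞, z]`. -/
noncomputable def halfLineInd : Set (ℝ → ℝ) :=
  {h | ∃ z : ℝ, h = (Set.Iic z).indicator (fun _ => (1 : ℝ))}

/-- The Wasserstein distance between two laws on `ℝ`. -/
noncomputable def wassersteinDist (μ ν : Measure ℝ) : ℝ≥0∞ := testDist lipOne μ ν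

/-- The Kolmogorov distance between two laws on `ℝ`. -/
noncomputable def kolmogorovDist (μ ν : Measure ℝ) : ℝ≥0∞ := testDist halfLineInd μ ν

/-- `(W'', W', G)`, under `Q`, is a zbest coupling for `W`, under `P`: the identity
`E_P[(W - E_P W) f(W)] = E_Q[G (f(W'') - f(W'))]` holds for all smooth `f` for which the two
expectations exist, and these functions include the compactly supported smooth ones. (Asking the
identity for smooth `f` only is undemanding: a triple that satisfies it for all absolutely
continuous, or for all measurable, `f` for which the expectations exist satisfies it here.) -/
structure IsZbest {Ω Ω' : Type*} [MeasurableSpace Ω] [MeasurableSpace Ω'] (P : Measure Ω)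
    (W : Ω → ℝ) (Q : Measure Ω') (W'' W' G : Ω' → ℝ) : Prop where
  integrable_of_hasCompactSupport : ∀ f : ℝ → ℝ, ContDiff ℝ (⊤ : ℕ∞) f → HasCompactSupport f →
    Integrable (fun ω => G ω * (f (W'' ω) - f (W' ω))) Q
  identity : ∀ f : ℝ → ℝ, ContDiff ℝ (⊤ : ℕ∞) f →
    Integrable (fun ω => (W ω - ∫ a, W a ∂P) * f (W ω)) P →
    Integrable (fun ω => G ω * (f (W'' ω) - f (W' ω))) Q →
    ∫ ω, (W ω - ∫ a, W a ∂P) * f (W ω) ∂P = ∫ ω, G ω * (f (W'' ω) - f (W' ω)) ∂Q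

/-!
The proof is Stein's method. Let `φ`, `Φ` be the standard normal density and distribution function.
For a test function `h`, let `f` solve Stein's equation `f'(w) - w f(w) = h(w) - E h(Z)`. Then
`E h(W) - E h(Z) = E f'(W) - E[W f(W)]`, and the coupling gives
`E[W f(W)] = E[G (f(W'') - f(W'))] = E[G D f'(W*)]`: the first equality is extended from smooth to
Lipschitz `f` by smoothing (`IsZbest.integral_eq_of_lipschitzWith`), the second is the mean value
formula in which `U` is the integration variable (`integral_mul_sub_eq_integral_mul_uniform`).

*Wasserstein distance.* One has `E h(W) - E h(Z) = E[f'(W) - f'(W*)] + E[(1 - G D) f'(W*)]`, so the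
claim follows from `|f''| ≤ 2` and `|f'| ≤ √(2/π)` for `h` smooth with `|h'| ≤ 1`. The solution and
its derivatives are written as combinations of `∫ t in (-∞, w], h' t Φ(t)` and its mirror image,
whose coefficients involve the iterated antiderivatives `Φ`, `J = φ + w Φ` (`stdJ`) and, up to a
factor `2`, `K = (1 + w²) Φ + w φ` (`stdK`) of `φ`. These are nonnegative because they are nondecreasing and vanish at
`-∞`. The bound on `f''` is then the identity `K(-w) J(w) + K(w) J(-w) = φ(w)`, and the bound on
`f'` is the inequality `J(w) J(-w) ≤ φ(w) φ(0)` (`stdJ_mul_neg_le`), which rests on the integral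
formula `stdCDF_mul_neg` for `Φ(w) Φ(-w)`.

*Kolmogorov distance.* For `h = 1_{(-∞, z]}` the solution satisfies `|f| ≤ √(2π)/4` and `|f'| ≤ 1`;
the first bound comes from the same formula for `Φ(w) Φ(-w)`. Here
`P(W* ≤ z) - Φ(z) = E[W f(W) - W* f(W*)] + E[(1 - G D) f'(W*)]`, where the first term is at most
`E(|W| + √(2π)/4) δ ≤ (1 + √(2π)/4) δ`. Passing from `W*` to `W` moves `z` by at most `δ`, which
costs a further `δ φ(0) = δ / √(2π)`.
-/

open Filter Topology Set

/-! ### The normal distribution function and its iterated antiderivatives -/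

/-- The standard normal density `φ`. -/
noncomputable def stdPDF (w : ℝ) : ℝ := (√(2 * Real.pi))⁻¹ * Real.exp (-w ^ 2 / 2)

/-- The standard normal distribution function `Φ`. -/
noncomputable def stdCDF (w : ℝ) : ℝ := cdf (gaussianReal 0 1) w

/-- The antiderivative `φ(w) + w Φ(w)` of `Φ` that vanishes at `-∞`. -/
noncomputable def stdJ (w : ℝ) : ℝ := stdPDF w + w * stdCDF w

/-- Twice the antiderivative of `stdJ` that vanishes at `-∞`. -/
noncomputable def stdK (w : ℝ) : ℝ := (1 + w ^ 2) * stdCDF w + w * stdPDF w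

/-- The ratio `Φ / φ`. -/
noncomputable def millsRatio (w : ℝ) : ℝ := stdCDF w / stdPDF w

lemma stdPDF_pos (w : ℝ) : 0 < stdPDF w := by unfold stdPDF; positivity

lemma stdPDF_neg (w : ℝ) : stdPDF (-w) = stdPDF w := by simp [stdPDF]

lemma stdPDF_eq (w : ℝ) : stdPDF w = stdPDF 0 * Real.exp (-w ^ 2 / 2) := by simp [stdPDF]

lemma stdPDF_zero : stdPDF 0 = 1 / √(2 * Real.pi) := by simp [stdPDF]

lemma stdPDF_le (w : ℝ) : stdPDF w ≤ stdPDF 0 := by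
  rw [stdPDF_eq w]
  exact mul_le_of_le_one_right (stdPDF_pos 0).le
    (Real.exp_le_one_iff.2 (by nlinarith [sq_nonneg w]))

lemma gaussianPDFReal_eq_stdPDF : gaussianPDFReal 0 1 = stdPDF := by
  ext w; simp [gaussianPDFReal, stdPDF]

lemma hasDerivAt_stdPDF (w : ℝ) : HasDerivAt stdPDF (-w * stdPDF w) w := by
  have h : HasDerivAt (fun w : ℝ => -w ^ 2 / 2) (-w) w := by
    refine ((hasDerivAt_pow 2 w).neg.div_const 2).congr_deriv ?_
    simp
    ring
  refine (h.exp.const_mul (√(2 * Real.pi))⁻¹).congr_deriv ?_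
  simp only [stdPDF]; ring

lemma continuous_stdPDF : Continuous stdPDF :=
  continuous_iff_continuousAt.2 fun w => (hasDerivAt_stdPDF w).continuousAt

lemma integrable_stdPDF : Integrable stdPDF :=
  gaussianPDFReal_eq_stdPDF ▸ integrable_gaussianPDFReal 0 1

lemma integral_gaussianReal_eq (h : ℝ → ℝ) :
    ∫ x, h x ∂gaussianReal 0 1 = ∫ x, stdPDF x * h x := by
  rw [integral_gaussianReal_eq_integral_smul one_ne_zero, gaussianPDFReal_eq_stdPDF]; rfl

lemma stdCDF_eq_integral (w : ℝ) : stdCDF w = ∫ x in Iic w, stdPDF x := by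
  rw [stdCDF, cdf_eq_real, measureReal_def, gaussianReal_apply_eq_integral _ one_ne_zero,
    ENNReal.toReal_ofReal, gaussianPDFReal_eq_stdPDF]
  exact setIntegral_nonneg measurableSet_Iic fun x _ => gaussianPDFReal_nonneg _ _ _

lemma stdCDF_nonneg (w : ℝ) : 0 ≤ stdCDF w := cdf_nonneg _ _

lemma stdCDF_le_one (w : ℝ) : stdCDF w ≤ 1 := cdf_le_one _ _

lemma stdCDF_add_neg (w : ℝ) : stdCDF w + stdCDF (-w) = 1 := by
  have h1 : stdCDF (-w) = ∫ x in Ioi w, stdPDF x := by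
    rw [stdCDF_eq_integral, ← integral_comp_neg_Ioi]; simp [stdPDF_neg]
  rw [h1, stdCDF_eq_integral, ← compl_Iic, integral_add_compl measurableSet_Iic integrable_stdPDF,
    ← gaussianPDFReal_eq_stdPDF, integral_gaussianPDFReal_eq_one _ one_ne_zero]

/-- The derivative of `x ↦ ∫ t in (-∞, x], g t` is `g`, for `g` continuous and integrable on left
half lines. -/
lemma hasDerivAt_integral_Iic {g : ℝ → ℝ} (hg : Continuous g) (hi : ∀ w, IntegrableOn g (Iic w))
    (w : ℝ) : HasDerivAt (fun x => ∫ t in Iic x, g t) (g w) w := by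
  have h : (fun x => ∫ t in Iic x, g t)
      = fun x => (∫ t in (0 : ℝ)..x, g t) + ∫ t in Iic 0, g t := by
    ext x
    rw [← intervalIntegral.integral_Iic_sub_Iic (hi 0) (hi x)]; ring
  rw [h]
  exact (intervalIntegral.integral_hasDerivAt_right (hg.intervalIntegrable _ _)
    (hg.stronglyMeasurableAtFilter _ _) hg.continuousAt).add_const _

lemma hasDerivAt_stdCDF (w : ℝ) : HasDerivAt stdCDF (stdPDF w) w := by
  rw [show stdCDF = fun w => ∫ x in Iic w, stdPDF x from funext stdCDF_eq_integral]
  exact hasDerivAt_integral_Iic continuous_stdPDF (fun _ => integrable_stdPDF.integrableOn) w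

lemma continuous_stdCDF : Continuous stdCDF :=
  continuous_iff_continuousAt.2 fun w => (hasDerivAt_stdCDF w).continuousAt

lemma monotone_stdCDF : Monotone stdCDF := monotone_cdf _

lemma hasDerivAt_stdJ (w : ℝ) : HasDerivAt stdJ (stdCDF w) w := by
  refine ((hasDerivAt_stdPDF w).add ((hasDerivAt_id w).mul (hasDerivAt_stdCDF w))).congr_deriv ?_
  simp

lemma hasDerivAt_stdK (w : ℝ) : HasDerivAt stdK (2 * stdJ w) w := by
  refine ((((hasDerivAt_pow 2 w).const_add 1).mul (hasDerivAt_stdCDF w)).add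
    ((hasDerivAt_id w).mul (hasDerivAt_stdPDF w))).congr_deriv ?_
  simp [stdJ]; ring

lemma hasDerivAt_millsRatio (w : ℝ) : HasDerivAt millsRatio (w * millsRatio w + 1) w := by
  have hp := (stdPDF_pos w).ne'
  refine ((hasDerivAt_stdCDF w).div (hasDerivAt_stdPDF w) hp).congr_deriv ?_
  rw [millsRatio]; field_simp; ring

/-- A function that is nondecreasing on a left half line and vanishes at `-∞` is nonnegative. -/
lemma nonneg_of_deriv_nonneg_of_tendsto_atBot {g g' : ℝ → ℝ} {c : ℝ}
    (hd : ∀ x, HasDerivAt g (g' x) x) (hg' : ∀ x ≤ c, 0 ≤ g' x) (hlim : Tendsto g atBot (𝓝 0))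
    {x : ℝ} (hx : x ≤ c) : 0 ≤ g x := by
  have hmono : MonotoneOn g (Iic c) := by
    refine monotoneOn_of_deriv_nonneg (convex_Iic c)
      (fun y _ => (hd y).continuousAt.continuousWithinAt)
      (fun y _ => (hd y).differentiableAt.differentiableWithinAt) fun y hy => ?_
    rw [interior_Iic] at hy
    rw [(hd y).deriv]
    exact hg' y (le_of_lt hy)
  refine le_of_tendsto hlim ?_
  filter_upwards [eventually_le_atBot x] with y hy
  exact hmono (hy.trans hx) hx hy

lemma tendsto_pow_mul_stdPDF_atBot (n : ℕ) :
    Tendsto (fun w => w ^ n * stdPDF w) atBot (𝓝 0) := by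
  have h := (Real.tendsto_pow_mul_exp_neg_atTop_nhds_zero n).comp tendsto_neg_atBot_atTop
  refine squeeze_zero_norm' ?_ h
  filter_upwards [eventually_le_atBot (-2 : ℝ)] with w hw
  have h1 : stdPDF w ≤ Real.exp w := by
    have hs : (√(2 * Real.pi))⁻¹ ≤ 1 := by
      apply inv_le_one_of_one_le₀
      rw [Real.one_le_sqrt]
      linarith [Real.pi_gt_three]
    have he : Real.exp (-w ^ 2 / 2) ≤ Real.exp w := Real.exp_le_exp.2 (by nlinarith)
    calc stdPDF w ≤ 1 * Real.exp (-w ^ 2 / 2) :=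
          mul_le_mul_of_nonneg_right hs (Real.exp_pos _).le
      _ ≤ _ := by rw [one_mul]; exact he
  rw [norm_mul, norm_pow, Real.norm_eq_abs, Real.norm_eq_abs, abs_of_pos (stdPDF_pos w),
    abs_of_nonpos (by linarith : w ≤ 0)]
  have hw0 : 0 ≤ -w := by linarith
  simpa using mul_le_mul_of_nonneg_left h1 (pow_nonneg hw0 n)

lemma stdCDF_le_stdPDF {w : ℝ} (hw : w ≤ -1) : stdCDF w ≤ stdPDF w := by
  have := nonneg_of_deriv_nonneg_of_tendsto_atBot (g := fun w => stdPDF w - stdCDF w)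
    (fun x => (hasDerivAt_stdPDF x).sub (hasDerivAt_stdCDF x)) (c := -1)
    (fun x hx => by nlinarith [stdPDF_pos x])
    (by simpa [stdCDF] using
      (tendsto_pow_mul_stdPDF_atBot 0).sub (tendsto_cdf_atBot (gaussianReal 0 1))) hw
  linarith

lemma tendsto_pow_mul_stdCDF_atBot (n : ℕ) :
    Tendsto (fun w => w ^ n * stdCDF w) atBot (𝓝 0) := by
  refine squeeze_zero_norm' ?_ (tendsto_zero_iff_norm_tendsto_zero.1
    (tendsto_pow_mul_stdPDF_atBot n))
  filter_upwards [eventually_le_atBot (-1 : ℝ)] with w hw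
  rw [norm_mul, norm_mul]
  refine mul_le_mul_of_nonneg_left ?_ (norm_nonneg _)
  rw [Real.norm_of_nonneg (stdCDF_nonneg w), Real.norm_of_nonneg (stdPDF_pos w).le]
  exact stdCDF_le_stdPDF hw

lemma tendsto_stdJ_atBot : Tendsto stdJ atBot (𝓝 0) := by
  have := (tendsto_pow_mul_stdPDF_atBot 0).add (tendsto_pow_mul_stdCDF_atBot 1)
  simp only [add_zero] at this
  refine this.congr fun w => ?_
  simp only [stdJ]; ring

lemma tendsto_stdK_atBot : Tendsto stdK atBot (𝓝 0) := by
  have := ((tendsto_pow_mul_stdCDF_atBot 0).add (tendsto_pow_mul_stdCDF_atBot 2)).add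
    (tendsto_pow_mul_stdPDF_atBot 1)
  simp only [add_zero] at this
  refine this.congr fun w => ?_
  simp only [stdK]; ring

lemma stdJ_nonneg (w : ℝ) : 0 ≤ stdJ w :=
  nonneg_of_deriv_nonneg_of_tendsto_atBot hasDerivAt_stdJ (fun x _ => stdCDF_nonneg x)
    tendsto_stdJ_atBot le_rfl

/-- The lower bound for the Gaussian tail, `|w| φ(w) / (1 + w ^ 2) ≤ Φ(w)` for `w ≤ 0`. -/
lemma stdK_nonneg (w : ℝ) : 0 ≤ stdK w :=
  nonneg_of_deriv_nonneg_of_tendsto_atBot hasDerivAt_stdK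
    (fun x _ => mul_nonneg zero_le_two (stdJ_nonneg x)) tendsto_stdK_atBot le_rfl

/-! ### The product of the two Gaussian tails -/

lemma stdCDF_zero : stdCDF 0 = 1 / 2 := by
  have := stdCDF_add_neg 0
  rw [neg_zero] at this; linarith

/-- The mass of `[-w, w]` as an integral over `[0, 1]`, obtained by rescaling. -/
lemma stdCDF_sub_neg (w : ℝ) :
    stdCDF w - stdCDF (-w) = 2 * w * ∫ u in (0 : ℝ)..1, stdPDF (w * u) := by
  have h1 : w * ∫ u in (0 : ℝ)..1, stdPDF (w * u) = ∫ x in (0 : ℝ)..w, stdPDF x := by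
    have := intervalIntegral.smul_integral_comp_mul_left (a := 0) (b := 1) stdPDF w
    simpa only [smul_eq_mul, mul_zero, mul_one] using this
  have h2 : ∫ x in (0 : ℝ)..w, stdPDF x = stdCDF w - stdCDF 0 :=
    intervalIntegral.integral_eq_sub_of_hasDerivAt (fun x _ => hasDerivAt_stdCDF x)
      (continuous_stdPDF.intervalIntegrable _ _)
  have h3 := stdCDF_add_neg w
  rw [mul_assoc, h1, h2, stdCDF_zero]; linarith

lemma continuous_stdPDF_mul_div (w : ℝ) :
    Continuous fun u : ℝ => stdPDF (w * u) / (1 + u ^ 2) :=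
  (continuous_stdPDF.comp (continuous_const.mul continuous_id)).div (by fun_prop)
    fun u => by positivity

/-- Both sides have the same derivative in `w` and agree at `w = 0`. -/
lemma stdCDF_mul_neg (w : ℝ) :
    stdCDF w * stdCDF (-w) = stdPDF w * (2 * ∫ u in (0 : ℝ)..1, stdPDF (w * u) / (1 + u ^ 2)) := by
  have hpp : ∀ w u : ℝ, stdPDF w * (2 * (stdPDF (w * u) / (1 + u ^ 2)))
      = Real.pi⁻¹ * (Real.exp (-(w ^ 2 * (1 + u ^ 2)) / 2) / (1 + u ^ 2)) := by
    intro w u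
    have hs : √(2 * Real.pi) ^ 2 = 2 * Real.pi := Real.sq_sqrt (by positivity)
    have he : Real.exp (-(w ^ 2 * (1 + u ^ 2)) / 2)
        = Real.exp (-w ^ 2 / 2) * Real.exp (-(w * u) ^ 2 / 2) := by
      rw [← Real.exp_add]; ring_nf
    have hs' : (√(2 * Real.pi))⁻¹ * (√(2 * Real.pi))⁻¹ = Real.pi⁻¹ / 2 := by
      rw [← mul_inv, ← sq, hs]; field_simp
    simp only [stdPDF, he]
    linear_combination (Real.exp (-w ^ 2 / 2) * Real.exp (-(w * u) ^ 2 / 2) * 2 / (1 + u ^ 2)) * hs'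
  have hrhs : ∀ w, stdPDF w * (2 * ∫ u in (0 : ℝ)..1, stdPDF (w * u) / (1 + u ^ 2))
      = Real.pi⁻¹ * ∫ u in (0 : ℝ)..1, Real.exp (-(w ^ 2 * (1 + u ^ 2)) / 2) / (1 + u ^ 2) := by
    intro w
    rw [← intervalIntegral.integral_const_mul, ← intervalIntegral.integral_const_mul,
      ← intervalIntegral.integral_const_mul]
    simp_rw [hpp]
  have hder : ∀ w, HasDerivAt (fun w => Real.pi⁻¹ *
      ∫ u in (0 : ℝ)..1, Real.exp (-(w ^ 2 * (1 + u ^ 2)) / 2) / (1 + u ^ 2))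
      (stdPDF w * (stdCDF (-w) - stdCDF w)) w := by
    intro w
    have hd : ∀ x u : ℝ, HasDerivAt
        (fun x : ℝ => Real.exp (-(x ^ 2 * (1 + u ^ 2)) / 2) / (1 + u ^ 2))
        (-x * Real.exp (-(x ^ 2 * (1 + u ^ 2)) / 2)) x := by
      intro x u
      have h0 : (1 + u ^ 2) ≠ 0 := by positivity
      have h : HasDerivAt (fun x : ℝ => -(x ^ 2 * (1 + u ^ 2)) / 2) (-x * (1 + u ^ 2)) x := by
        refine (((hasDerivAt_pow 2 x).mul_const (1 + u ^ 2)).neg.div_const 2).congr_deriv ?_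
        simp; ring
      refine (h.exp.div_const (1 + u ^ 2)).congr_deriv ?_
      field_simp
    have key := intervalIntegral.hasDerivAt_integral_of_dominated_loc_of_deriv_le
      (μ := volume) (a := 0) (b := 1) (x₀ := w) (s := Metric.ball w 1)
      (bound := fun _ => |w| + 1)
      (F := fun x u => Real.exp (-(x ^ 2 * (1 + u ^ 2)) / 2) / (1 + u ^ 2))
      (F' := fun x u => -x * Real.exp (-(x ^ 2 * (1 + u ^ 2)) / 2))
      (Metric.ball_mem_nhds w one_pos)
      (Eventually.of_forall fun x => by
        refine Continuous.aestronglyMeasurable ?_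
        exact Continuous.div (by fun_prop) (by fun_prop) fun u => by positivity)
      (by
        refine Continuous.intervalIntegrable ?_ _ _
        exact Continuous.div (by fun_prop) (by fun_prop) fun u => by positivity)
      (Continuous.aestronglyMeasurable (by fun_prop))
      (ae_of_all _ fun u _ x hx => by
        have hx' : |x| ≤ |w| + 1 := by
          rw [Metric.mem_ball, Real.dist_eq] at hx
          have := abs_add_le (x - w) w
          rw [sub_add_cancel] at this
          linarith
        rw [norm_mul, norm_neg, Real.norm_eq_abs, Real.norm_eq_abs, Real.abs_exp]
        refine (mul_le_of_le_one_right (abs_nonneg x) (Real.exp_le_one_iff.2 ?_)).trans hx'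
        have : 0 ≤ x ^ 2 * (1 + u ^ 2) := by positivity
        linarith)
      (intervalIntegrable_const)
      (ae_of_all _ fun u _ x _ => hd x u)
    refine (key.2.const_mul Real.pi⁻¹).congr_deriv ?_
    have h1 := stdCDF_sub_neg w
    have h2 : stdPDF w * (stdCDF (-w) - stdCDF w)
        = stdPDF w * (-(2 * w * ∫ u in (0 : ℝ)..1, stdPDF (w * u))) := by rw [← h1]; ring
    have h4 : ∀ c : ℝ, stdPDF w * -(2 * w * c) = -(stdPDF w * 2 * w) * c := fun c => by ring
    rw [h2, h4, ← intervalIntegral.integral_const_mul, ← intervalIntegral.integral_const_mul]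
    congr 1; ext u
    have h0 : (1 + u ^ 2) ≠ 0 := by positivity
    have := hpp w u
    have h3 : stdPDF w * (2 * stdPDF (w * u))
        = Real.pi⁻¹ * Real.exp (-(w ^ 2 * (1 + u ^ 2)) / 2) := by
      field_simp at this ⊢
      linarith
    linear_combination w * h3
  have hder2 : ∀ w, HasDerivAt (fun w => stdCDF w * stdCDF (-w))
      (stdPDF w * (stdCDF (-w) - stdCDF w)) w := by
    intro w
    have h : HasDerivAt (fun w => stdCDF (-w)) (-stdPDF w) w := by
      refine ((hasDerivAt_stdCDF (-w)).scomp w (hasDerivAt_neg w)).congr_deriv ?_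
      simp [stdPDF_neg]
    refine ((hasDerivAt_stdCDF w).mul h).congr_deriv ?_
    ring
  have hconst := is_const_of_deriv_eq_zero
    (f := fun w => stdCDF w * stdCDF (-w) - Real.pi⁻¹ *
      ∫ u in (0 : ℝ)..1, Real.exp (-(w ^ 2 * (1 + u ^ 2)) / 2) / (1 + u ^ 2))
    (fun w => ((hder2 w).sub (hder w)).differentiableAt)
    (fun w => by
      have := ((hder2 w).sub (hder w)).deriv
      rw [sub_self] at this
      exact this) w 0
  have h0 : ∫ u in (0 : ℝ)..1, Real.exp (-((0 : ℝ) ^ 2 * (1 + u ^ 2)) / 2) / (1 + u ^ 2)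
      = Real.pi / 4 := by simp
  rw [hrhs]
  simp only [h0, neg_zero, stdCDF_zero] at hconst
  have hpi : Real.pi⁻¹ * (Real.pi / 4) = 1 / 4 := by field_simp
  rw [hpi] at hconst
  linarith

/-- `Φ(w) Φ(-w) ≤ φ(w) √(2π) / 4`. -/
lemma stdCDF_mul_neg_le (w : ℝ) :
    stdCDF w * stdCDF (-w) ≤ stdPDF w * (√(2 * Real.pi) / 4) := by
  rw [stdCDF_mul_neg]
  refine mul_le_mul_of_nonneg_left ?_ (stdPDF_pos w).le
  have h : ∫ u in (0 : ℝ)..1, stdPDF (w * u) / (1 + u ^ 2)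
      ≤ ∫ u in (0 : ℝ)..1, stdPDF 0 * (1 + u ^ 2)⁻¹ := by
    refine intervalIntegral.integral_mono_on zero_le_one
      ((continuous_stdPDF_mul_div w).intervalIntegrable _ _) ?_ fun u _ => ?_
    · exact Continuous.intervalIntegrable (Continuous.mul (by fun_prop)
        (Continuous.inv₀ (by fun_prop) fun u => by positivity)) _ _
    · rw [div_eq_mul_inv]
      exact mul_le_mul_of_nonneg_right (stdPDF_le _) (by positivity)
  rw [intervalIntegral.integral_const_mul, integral_inv_one_add_sq, stdPDF_zero] at h
  simp only [Real.arctan_one, Real.arctan_zero, sub_zero] at h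
  have hs : √(2 * Real.pi) ^ 2 = 2 * Real.pi := Real.sq_sqrt (by positivity)
  have hs0 : 0 < √(2 * Real.pi) := by positivity
  have : 1 / √(2 * Real.pi) * (Real.pi / 4) = √(2 * Real.pi) / 8 := by
    field_simp; linarith
  linarith

/-- With `J(w) = φ(w) + w Φ(w)`, the integral formulas for `Φ(w) - Φ(-w)` and `Φ(w) Φ(-w)` give
`J(w) J(-w) / φ(w) = φ(w) + ∫ u in 0..1, 2 w² u φ(w u) * (u / (1 + u²))`; the bound follows from
`u / (1 + u²) ≤ 1 / 2`, since `-w² u φ(w u)` is the `u`-derivative of `φ(w u)`. -/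
lemma stdJ_mul_neg_le (w : ℝ) : stdJ w * stdJ (-w) ≤ stdPDF w * stdPDF 0 := by
  have hc : Continuous fun u : ℝ => stdPDF (w * u) :=
    continuous_stdPDF.comp (continuous_const.mul continuous_id)
  have hI : ∫ u in (0 : ℝ)..1, -(w ^ 2 * u * stdPDF (w * u)) = stdPDF w - stdPDF 0 := by
    have := intervalIntegral.integral_eq_sub_of_hasDerivAt (a := 0) (b := 1)
      (f := fun u => stdPDF (w * u)) (f' := fun u => -(w ^ 2 * u * stdPDF (w * u)))
      (fun u _ => by
        have hm : HasDerivAt (fun u : ℝ => w * u) w u := by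
          simpa using (hasDerivAt_id u).const_mul w
        refine ((hasDerivAt_stdPDF (w * u)).comp u hm).congr_deriv ?_
        ring)
      (Continuous.intervalIntegrable (by fun_prop) _ _)
    simpa using this
  have hle : ∫ u in (0 : ℝ)..1, w ^ 2 * (2 * stdPDF (w * u) - 2 * (stdPDF (w * u) / (1 + u ^ 2)))
      ≤ ∫ u in (0 : ℝ)..1, w ^ 2 * u * stdPDF (w * u) := by
    refine intervalIntegral.integral_mono_on zero_le_one ?_ ?_ fun u hu => ?_
    · exact Continuous.intervalIntegrable (continuous_const.mul
        ((continuous_const.mul hc).sub (continuous_const.mul (continuous_stdPDF_mul_div w)))) _ _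
    · exact Continuous.intervalIntegrable (by fun_prop) _ _
    · have h0 : 0 < 1 + u ^ 2 := by positivity
      have : w ^ 2 * u * stdPDF (w * u)
          - w ^ 2 * (2 * stdPDF (w * u) - 2 * (stdPDF (w * u) / (1 + u ^ 2)))
          = w ^ 2 * stdPDF (w * u) * (u * (1 - u) ^ 2 / (1 + u ^ 2)) := by
        field_simp; ring
      have h2 : 0 ≤ w ^ 2 * stdPDF (w * u) * (u * (1 - u) ^ 2 / (1 + u ^ 2)) := by
        have := hu.1
        have := (stdPDF_pos (w * u)).le
        positivity
      linarith
  have hsub : ∫ u in (0 : ℝ)..1, (2 * stdPDF (w * u) - 2 * (stdPDF (w * u) / (1 + u ^ 2)))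
      = (∫ u in (0 : ℝ)..1, 2 * stdPDF (w * u))
        - ∫ u in (0 : ℝ)..1, 2 * (stdPDF (w * u) / (1 + u ^ 2)) :=
    intervalIntegral.integral_sub ((continuous_const.mul hc).intervalIntegrable _ _)
      ((continuous_const.mul (continuous_stdPDF_mul_div w)).intervalIntegrable _ _)
  rw [intervalIntegral.integral_const_mul, hsub, intervalIntegral.integral_const_mul,
    intervalIntegral.integral_const_mul] at hle
  rw [intervalIntegral.integral_neg] at hI
  have h1 := stdCDF_sub_neg w
  have h2 := stdCDF_mul_neg w
  have hp := stdPDF_pos w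
  have h3 : stdJ w * stdJ (-w) = stdPDF w * (stdPDF w
      + w ^ 2 * (2 * (∫ u in (0 : ℝ)..1, stdPDF (w * u))
        - 2 * ∫ u in (0 : ℝ)..1, stdPDF (w * u) / (1 + u ^ 2))) := by
    simp only [stdJ, stdPDF_neg]
    linear_combination stdPDF w * w * h1 - w ^ 2 * h2
  rw [h3]
  exact mul_le_mul_of_nonneg_left (by linarith) hp.le

/-! ### Stein's equation for a Lipschitz test function -/

lemma integrableOn_stdCDF_Iic (w : ℝ) : IntegrableOn stdCDF (Iic w) := by
  have h : IntegrableOn (fun x => stdCDF (-x)) (Ioi (-w)) := by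
    refine integrableOn_Ioi_deriv_of_nonneg' (g := fun x => -stdJ (-x)) (l := 0) (fun x _ => ?_)
      (fun x _ => stdCDF_nonneg _) ?_
    · refine (((hasDerivAt_stdJ (-x)).scomp x (hasDerivAt_neg x)).neg).congr_deriv ?_
      simp
    · simpa using (tendsto_stdJ_atBot.comp tendsto_neg_atTop_atBot).neg
  rw [← integrableOn_Ici_iff_integrableOn_Ioi] at h
  simpa using h.comp_neg

lemma integral_stdCDF_Iic (w : ℝ) : ∫ t in Iic w, stdCDF t = stdJ w := by
  rw [integral_Iic_of_hasDerivAt_of_tendsto' (fun x _ => hasDerivAt_stdJ x)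
    (integrableOn_stdCDF_Iic w) tendsto_stdJ_atBot, sub_zero]

/-- The integral `∫ t in (-∞, w], p t Φ(t)`. -/
noncomputable def cdfIntegral (p : ℝ → ℝ) (w : ℝ) : ℝ := ∫ t in Iic w, p t * stdCDF t

lemma integrableOn_mul_stdCDF {p : ℝ → ℝ} (hp : Continuous p) (hp1 : ∀ x, |p x| ≤ 1) (w : ℝ) :
    IntegrableOn (fun t => p t * stdCDF t) (Iic w) :=
  (integrableOn_stdCDF_Iic w).bdd_mul (c := 1) hp.aestronglyMeasurable (ae_of_all _ hp1)

lemma hasDerivAt_cdfIntegral {p : ℝ → ℝ} (hp : Continuous p) (hp1 : ∀ x, |p x| ≤ 1) (w : ℝ) :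
    HasDerivAt (cdfIntegral p) (p w * stdCDF w) w :=
  hasDerivAt_integral_Iic (hp.mul continuous_stdCDF) (integrableOn_mul_stdCDF hp hp1) w

lemma abs_cdfIntegral_le {p : ℝ → ℝ} (hp1 : ∀ x, |p x| ≤ 1) (w : ℝ) :
    |cdfIntegral p w| ≤ stdJ w := by
  rw [← integral_stdCDF_Iic]
  refine norm_integral_le_of_norm_le (f := fun t => p t * stdCDF t) (integrableOn_stdCDF_Iic w)
    (ae_of_all _ fun t => ?_)
  rw [norm_mul, Real.norm_of_nonneg (stdCDF_nonneg t)]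
  exact mul_le_of_le_one_left (stdCDF_nonneg t) (hp1 t)

/-- The bounded solution of Stein's equation `f'(w) - w f(w) = h(w) - ∫ h dN(0,1)`, expressed
through the derivative `p` of `h`. -/
noncomputable def steinSol (p : ℝ → ℝ) (w : ℝ) : ℝ :=
  -(millsRatio (-w) * cdfIntegral p w + millsRatio w * cdfIntegral (fun t => p (-t)) (-w))

/-- The derivative of `steinSol p`. -/
noncomputable def steinSolDeriv (p : ℝ → ℝ) (w : ℝ) : ℝ :=
  (stdJ (-w) * cdfIntegral p w - stdJ w * cdfIntegral (fun t => p (-t)) (-w)) / stdPDF w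

/-- The second derivative of `steinSol p`. -/
noncomputable def steinSolDeriv₂ (p : ℝ → ℝ) (w : ℝ) : ℝ :=
  p w - (stdK (-w) * cdfIntegral p w + stdK w * cdfIntegral (fun t => p (-t)) (-w)) / stdPDF w

lemma LipschitzWith.integrable_of_integrable_id {μ : Measure ℝ} [IsFiniteMeasure μ]
    (hμ : Integrable (fun x : ℝ => x) μ) {h : ℝ → ℝ} {K : NNReal} (hh : LipschitzWith K h) :
    Integrable h μ := by
  refine ((hμ.abs.const_mul K).add (integrable_const |h 0|)).mono'
    hh.continuous.aestronglyMeasurable (ae_of_all _ fun x => ?_)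
  have h1 := hh.dist_le_mul x 0
  rw [Real.dist_eq, Real.dist_eq, sub_zero] at h1
  have h2 := abs_add_le (h x - h 0) (h 0)
  rw [sub_add_cancel] at h2
  exact h2.trans (add_le_add h1 le_rfl)

lemma integrable_id_gaussianReal (m : ℝ) (v : NNReal) :
    Integrable (fun x : ℝ => x) (gaussianReal m v) :=
  memLp_one_iff_integrable.1 (memLp_id_gaussianReal' 1 (by simp))

section SteinSol

variable {p : ℝ → ℝ}

lemma hasDerivAt_cdfIntegral_neg (hp : Continuous p) (hp1 : ∀ x, |p x| ≤ 1) (w : ℝ) :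
    HasDerivAt (fun w => cdfIntegral (fun t => p (-t)) (-w)) (-(p w * stdCDF (-w))) w := by
  refine ((hasDerivAt_cdfIntegral (p := fun t => p (-t)) (hp.comp continuous_neg)
    (fun x => hp1 _) (-w)).scomp w (hasDerivAt_neg w)).congr_deriv ?_
  simp

lemma steinSolDeriv_sub_mul (p : ℝ → ℝ) (w : ℝ) :
    steinSolDeriv p w - w * steinSol p w
      = cdfIntegral p w - cdfIntegral (fun t => p (-t)) (-w) := by
  have hφ := (stdPDF_pos w).ne'
  simp only [steinSolDeriv, steinSol, millsRatio, stdJ, stdPDF_neg]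
  field_simp
  ring

lemma hasDerivAt_steinSol (hp : Continuous p) (hp1 : ∀ x, |p x| ≤ 1) (w : ℝ) :
    HasDerivAt (steinSol p) (steinSolDeriv p w) w := by
  have hφ := (stdPDF_pos w).ne'
  have hL : HasDerivAt (fun w => millsRatio (-w)) (-(-w * millsRatio (-w) + 1)) w := by
    refine ((hasDerivAt_millsRatio (-w)).scomp w (hasDerivAt_neg w)).congr_deriv ?_
    simp
  refine (((hL.mul (hasDerivAt_cdfIntegral hp hp1 w)).add
    ((hasDerivAt_millsRatio w).mul (hasDerivAt_cdfIntegral_neg hp hp1 w))).neg).congr_deriv ?_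
  simp only [steinSolDeriv, millsRatio, stdJ, stdPDF_neg]
  field_simp
  ring

lemma hasDerivAt_steinSolDeriv (hp : Continuous p) (hp1 : ∀ x, |p x| ≤ 1) (w : ℝ) :
    HasDerivAt (steinSolDeriv p) (steinSolDeriv₂ p w) w := by
  have hφ := (stdPDF_pos w).ne'
  have hJ : HasDerivAt (fun w => stdJ (-w)) (-stdCDF (-w)) w := by
    refine ((hasDerivAt_stdJ (-w)).scomp w (hasDerivAt_neg w)).congr_deriv ?_
    simp
  refine (((hJ.mul (hasDerivAt_cdfIntegral hp hp1 w)).sub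
    ((hasDerivAt_stdJ w).mul (hasDerivAt_cdfIntegral_neg hp hp1 w))).div
    (hasDerivAt_stdPDF w) hφ).congr_deriv ?_
  have h1 : stdCDF (-w) = 1 - stdCDF w := by linarith [stdCDF_add_neg w]
  simp only [steinSolDeriv₂, stdJ, stdK, stdPDF_neg, h1, Pi.mul_apply, Pi.sub_apply]
  field_simp
  ring

lemma continuous_steinSolDeriv (hp : Continuous p) (hp1 : ∀ x, |p x| ≤ 1) :
    Continuous (steinSolDeriv p) :=
  continuous_iff_continuousAt.2 fun w => (hasDerivAt_steinSolDeriv hp hp1 w).continuousAt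

/-- Boundedness of the solution: it makes `f φ` vanish at `±∞`, which fixes the constant in Stein's
equation. -/
lemma abs_steinSol_le (hp1 : ∀ x, |p x| ≤ 1) (w : ℝ) : |steinSol p w| ≤ 1 := by
  have hφ := stdPDF_pos w
  have hL : ∀ w, 0 ≤ millsRatio w := fun w => div_nonneg (stdCDF_nonneg w) (stdPDF_pos w).le
  have h1 : stdCDF (-w) = 1 - stdCDF w := by linarith [stdCDF_add_neg w]
  calc |steinSol p w| ≤ millsRatio (-w) * |cdfIntegral p w|
        + millsRatio w * |cdfIntegral (fun t => p (-t)) (-w)| := by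
        rw [steinSol, abs_neg]
        refine (abs_add_le _ _).trans ?_
        rw [abs_mul, abs_mul, abs_of_nonneg (hL _), abs_of_nonneg (hL _)]
    _ ≤ millsRatio (-w) * stdJ w + millsRatio w * stdJ (-w) := by
        gcongr
        · exact hL _
        · exact abs_cdfIntegral_le hp1 w
        · exact hL _
        · exact abs_cdfIntegral_le (fun x => hp1 _) (-w)
    _ = 1 := by
        simp only [millsRatio, stdJ, stdPDF_neg, h1]
        field_simp
        ring

lemma abs_steinSolDeriv_le (hp1 : ∀ x, |p x| ≤ 1) (w : ℝ) :
    |steinSolDeriv p w| ≤ √(2 / Real.pi) := by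
  have hφ := stdPDF_pos w
  have hc : 2 * stdPDF 0 = √(2 / Real.pi) := by
    rw [stdPDF_zero, Real.sqrt_mul zero_le_two, Real.sqrt_div zero_le_two]
    have : √(2 : ℝ) ^ 2 = 2 := Real.sq_sqrt zero_le_two
    have h0 : √(2 : ℝ) ≠ 0 := by positivity
    have h1 : √Real.pi ≠ 0 := by positivity
    field_simp
    linarith
  rw [steinSolDeriv, abs_div, abs_of_pos hφ, div_le_iff₀ hφ, ← hc]
  calc _ ≤ stdJ (-w) * |cdfIntegral p w| + stdJ w * |cdfIntegral (fun t => p (-t)) (-w)| := by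
        refine (abs_sub _ _).trans ?_
        rw [abs_mul, abs_mul, abs_of_nonneg (stdJ_nonneg _), abs_of_nonneg (stdJ_nonneg _)]
    _ ≤ stdJ (-w) * stdJ w + stdJ w * stdJ (-w) := by
        gcongr
        · exact stdJ_nonneg _
        · exact abs_cdfIntegral_le hp1 w
        · exact stdJ_nonneg _
        · exact abs_cdfIntegral_le (fun x => hp1 _) (-w)
    _ ≤ _ := by linarith [stdJ_mul_neg_le w]

lemma abs_steinSolDeriv₂_le (hp1 : ∀ x, |p x| ≤ 1) (w : ℝ) : |steinSolDeriv₂ p w| ≤ 2 := by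
  have hφ := stdPDF_pos w
  have h1 : stdCDF (-w) = 1 - stdCDF w := by linarith [stdCDF_add_neg w]
  have h : |stdK (-w) * cdfIntegral p w + stdK w * cdfIntegral (fun t => p (-t)) (-w)|
      ≤ stdPDF w := by
    calc _ ≤ stdK (-w) * |cdfIntegral p w| + stdK w * |cdfIntegral (fun t => p (-t)) (-w)| := by
          refine (abs_add_le _ _).trans ?_
          rw [abs_mul, abs_mul, abs_of_nonneg (stdK_nonneg _), abs_of_nonneg (stdK_nonneg _)]
      _ ≤ stdK (-w) * stdJ w + stdK w * stdJ (-w) := by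
          gcongr
          · exact stdK_nonneg _
          · exact abs_cdfIntegral_le hp1 w
          · exact stdK_nonneg _
          · exact abs_cdfIntegral_le (fun x => hp1 _) (-w)
      _ = stdPDF w := by
          simp only [stdJ, stdK, stdPDF_neg, h1]
          ring
  rw [steinSolDeriv₂]
  refine (abs_sub _ _).trans ?_
  have h2 : |(stdK (-w) * cdfIntegral p w + stdK w * cdfIntegral (fun t => p (-t)) (-w))
      / stdPDF w| ≤ 1 := by
    rw [abs_div, abs_of_pos hφ, div_le_one hφ]; exact h
  linarith [hp1 w]

lemma lipschitz_steinSolDeriv (hp : Continuous p) (hp1 : ∀ x, |p x| ≤ 1) (x y : ℝ) :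
    |steinSolDeriv p x - steinSolDeriv p y| ≤ 2 * |x - y| := by
  have := Convex.norm_image_sub_le_of_norm_hasDerivWithin_le (s := univ) (C := 2)
    (f := steinSolDeriv p)
    (fun x _ => (hasDerivAt_steinSolDeriv hp hp1 x).hasDerivWithinAt)
    (fun x _ => abs_steinSolDeriv₂_le hp1 x) convex_univ (mem_univ y) (mem_univ x)
  simpa using this

/-- `steinSol h'` solves Stein's equation. The two sides have the same derivative, and the constant
is determined by integrating against `φ`, where the left side contributes `(f φ)'`. -/
lemma steinSol_equation {h : ℝ → ℝ} (hp : Continuous p) (hp1 : ∀ x, |p x| ≤ 1)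
    (hh : ∀ x, HasDerivAt h (p x) x) (w : ℝ) :
    steinSolDeriv p w - w * steinSol p w = h w - ∫ x, h x ∂gaussianReal 0 1 := by
  have hconst := is_const_of_deriv_eq_zero
    (f := fun w => cdfIntegral p w - cdfIntegral (fun t => p (-t)) (-w) - h w)
    (fun w => (((hasDerivAt_cdfIntegral hp hp1 w).sub
      (hasDerivAt_cdfIntegral_neg hp hp1 w)).sub (hh w)).differentiableAt)
    (fun w => by
      have := (((hasDerivAt_cdfIntegral hp hp1 w).sub
        (hasDerivAt_cdfIntegral_neg hp hp1 w)).sub (hh w)).deriv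
      rw [show p w * stdCDF w - -(p w * stdCDF (-w)) - p w
        = p w * (stdCDF w + stdCDF (-w)) - p w by ring, stdCDF_add_neg, mul_one, sub_self] at this
      exact this)
  obtain ⟨c, hc⟩ : ∃ c, ∀ w, steinSolDeriv p w - w * steinSol p w = h w - c := by
    refine ⟨-(cdfIntegral p 0 - cdfIntegral (fun t => p (-t)) (-0) - h 0), fun w => ?_⟩
    rw [steinSolDeriv_sub_mul]
    linarith [hconst w 0]
  -- `(f φ)' = (h - c) φ` integrates to `0`, so `c` is the Gaussian mean of `h`
  have hd : ∀ w, HasDerivAt (fun w => steinSol p w * stdPDF w) (stdPDF w * (h w - c)) w := by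
    intro w
    refine ((hasDerivAt_steinSol hp hp1 w).mul (hasDerivAt_stdPDF w)).congr_deriv ?_
    rw [← hc w]; ring
  have hl : LipschitzWith 1 h := by
    refine lipschitzWith_of_nnnorm_deriv_le (fun x => (hh x).differentiableAt) fun x => ?_
    rw [(hh x).deriv, ← NNReal.coe_le_coe]
    simpa using hp1 x
  have hint : Integrable (fun x => h x) (gaussianReal 0 1) :=
    hl.integrable_of_integrable_id (integrable_id_gaussianReal 0 1)
  have hint2 : Integrable (fun x => stdPDF x * (h x - c)) := by
    have h1 := hint.sub (integrable_const c)
    rw [gaussianReal_of_var_ne_zero _ one_ne_zero,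
      integrable_withDensity_iff_integrable_smul₀' (measurable_gaussianPDF 0 1).aemeasurable
        (ae_of_all _ fun x => gaussianPDF_lt_top)] at h1
    simpa [toReal_gaussianPDF, gaussianPDFReal_eq_stdPDF] using h1
  have hφ0 : ∀ l : Filter ℝ, Tendsto stdPDF l (𝓝 0) →
      Tendsto (fun w => steinSol p w * stdPDF w) l (𝓝 0) := by
    intro l hl
    refine squeeze_zero_norm (fun w => ?_) hl
    rw [norm_mul, Real.norm_of_nonneg (stdPDF_pos w).le]
    exact mul_le_of_le_one_left (stdPDF_pos w).le (abs_steinSol_le hp1 w)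
  have hbot : Tendsto stdPDF atBot (𝓝 0) := by simpa using tendsto_pow_mul_stdPDF_atBot 0
  have htop : Tendsto stdPDF atTop (𝓝 0) := by
    simpa [Function.comp_def, stdPDF_neg] using hbot.comp tendsto_neg_atTop_atBot
  have hzero := integral_of_hasDerivAt_of_tendsto hd hint2 (hφ0 _ hbot) (hφ0 _ htop)
  rw [← integral_gaussianReal_eq (fun x => h x - c), integral_sub hint (integrable_const c)]
    at hzero
  simp at hzero
  rw [hc w]
  linarith

end SteinSol

/-! ### Stein's equation for the indicator of a half line -/

/-- The bounded solution of Stein's equation for the indicator of `(-∞, z]`. -/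
noncomputable def halfLineSol (z w : ℝ) : ℝ :=
  if w ≤ z then millsRatio w * stdCDF (-z) else stdCDF z * millsRatio (-w)

/-- The derivative of `halfLineSol z`, with its value at the kink `z` chosen so that Stein's
equation `f'(w) - w f(w) = 1_{w ≤ z} - Φ(z)` holds everywhere. -/
noncomputable def halfLineSolDeriv (z w : ℝ) : ℝ :=
  w * halfLineSol z w + (Iic z).indicator (fun _ => (1 : ℝ)) w - stdCDF z

lemma millsRatio_nonneg (w : ℝ) : 0 ≤ millsRatio w :=
  div_nonneg (stdCDF_nonneg w) (stdPDF_pos w).le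

lemma mul_millsRatio_add_one (w : ℝ) : w * millsRatio w + 1 = stdJ w / stdPDF w := by
  have := (stdPDF_pos w).ne'
  rw [millsRatio, stdJ]; field_simp; ring

lemma mul_millsRatio_add_one_nonneg (w : ℝ) : 0 ≤ w * millsRatio w + 1 := by
  rw [mul_millsRatio_add_one]
  exact div_nonneg (stdJ_nonneg w) (stdPDF_pos w).le

lemma monotone_millsRatio : Monotone millsRatio :=
  monotone_of_hasDerivAt_nonneg hasDerivAt_millsRatio mul_millsRatio_add_one_nonneg

lemma continuous_millsRatio : Continuous millsRatio :=
  continuous_iff_continuousAt.2 fun w => (hasDerivAt_millsRatio w).continuousAt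

lemma millsRatio_mul_le {w z : ℝ} (h : w ≤ z) :
    millsRatio w * stdCDF (-z) ≤ √(2 * Real.pi) / 4 := by
  refine (mul_le_mul_of_nonneg_right (monotone_millsRatio h) (stdCDF_nonneg _)).trans ?_
  rw [millsRatio, div_mul_eq_mul_div, div_le_iff₀ (stdPDF_pos z), mul_comm (√_ / 4)]
  exact stdCDF_mul_neg_le z

/-- The upper bound for the derivative of `halfLineSol z` on `(-∞, z]`. For `w ≥ 0` it comes from
`w Φ(-w) ≤ φ(w)`; the bound on `(z, ∞)` is its mirror image. -/
lemma stdCDF_neg_mul_le_one {w z : ℝ} (h : w ≤ z) :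
    stdCDF (-z) * (w * millsRatio w + 1) ≤ 1 := by
  rcases le_total w 0 with hw | hw
  · have h1 : w * millsRatio w + 1 ≤ 1 := by
      linarith [mul_nonpos_of_nonpos_of_nonneg hw (millsRatio_nonneg w)]
    exact mul_le_one₀ (stdCDF_le_one _) (mul_millsRatio_add_one_nonneg w) h1
  · have h1 : w * stdCDF (-w) ≤ stdPDF w := by
      have := stdJ_nonneg (-w)
      rw [stdJ, stdPDF_neg] at this
      linarith
    have h2 : stdCDF (-z) * (w * millsRatio w) ≤ stdCDF z :=
      calc stdCDF (-z) * (w * millsRatio w) ≤ stdCDF (-w) * (w * millsRatio w) :=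
            mul_le_mul_of_nonneg_right (monotone_stdCDF (neg_le_neg h))
              (mul_nonneg hw (millsRatio_nonneg w))
        _ = (w * stdCDF (-w)) / stdPDF w * stdCDF w := by rw [millsRatio]; ring
        _ ≤ 1 * stdCDF w := by
            gcongr
            · exact stdCDF_nonneg w
            · rwa [div_le_one (stdPDF_pos w)]
        _ ≤ stdCDF z := by rw [one_mul]; exact monotone_stdCDF h
    linarith [stdCDF_add_neg z]

lemma abs_halfLineSol_le (z w : ℝ) : |halfLineSol z w| ≤ √(2 * Real.pi) / 4 := by
  rw [halfLineSol]
  split_ifs with h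
  · rw [abs_of_nonneg (mul_nonneg (millsRatio_nonneg _) (stdCDF_nonneg _))]
    exact millsRatio_mul_le h
  · rw [abs_of_nonneg (mul_nonneg (stdCDF_nonneg _) (millsRatio_nonneg _)), mul_comm]
    simpa using millsRatio_mul_le (w := -w) (z := -z) (by linarith)

lemma halfLineSolDeriv_of_le {z w : ℝ} (h : w ≤ z) :
    halfLineSolDeriv z w = stdCDF (-z) * (w * millsRatio w + 1) := by
  rw [halfLineSolDeriv, halfLineSol, if_pos h, indicator_of_mem (mem_Iic.2 h)]
  linarith [stdCDF_add_neg z]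

lemma halfLineSolDeriv_of_lt {z w : ℝ} (h : z < w) :
    halfLineSolDeriv z w = -(stdCDF z * (-w * millsRatio (-w) + 1)) := by
  rw [halfLineSolDeriv, halfLineSol, if_neg (not_le.2 h),
    indicator_of_notMem (by simpa using h)]
  ring

lemma abs_halfLineSolDeriv_le (z w : ℝ) : |halfLineSolDeriv z w| ≤ 1 := by
  rcases le_or_gt w z with h | h
  · rw [halfLineSolDeriv_of_le h,
      abs_of_nonneg (mul_nonneg (stdCDF_nonneg _) (mul_millsRatio_add_one_nonneg w))]
    exact stdCDF_neg_mul_le_one h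
  · rw [halfLineSolDeriv_of_lt h, abs_neg,
      abs_of_nonneg (mul_nonneg (stdCDF_nonneg _) (mul_millsRatio_add_one_nonneg _))]
    simpa using stdCDF_neg_mul_le_one (w := -w) (z := -z) (by linarith)

lemma continuous_halfLineSol (z : ℝ) : Continuous (halfLineSol z) := by
  refine Continuous.if_le (continuous_millsRatio.mul continuous_const)
    (continuous_const.mul (continuous_millsRatio.comp continuous_neg)) continuous_id
    continuous_const ?_
  rintro w rfl
  simp only [millsRatio, stdPDF_neg]
  ring

lemma measurable_halfLineSolDeriv (z : ℝ) : Measurable (halfLineSolDeriv z) :=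
  ((measurable_id.mul (continuous_halfLineSol z).measurable).add
    (measurable_const.indicator measurableSet_Iic)).sub_const _

lemma hasDerivAt_halfLineSol {z w : ℝ} (h : w ≠ z) :
    HasDerivAt (halfLineSol z) (halfLineSolDeriv z w) w := by
  rcases h.lt_or_gt with h | h
  · rw [halfLineSolDeriv_of_le h.le, mul_comm]
    refine ((hasDerivAt_millsRatio w).mul_const (stdCDF (-z))).congr_of_eventuallyEq ?_
    filter_upwards [Iio_mem_nhds h] with x hx
    rw [halfLineSol, if_pos (le_of_lt hx)]
  · rw [halfLineSolDeriv_of_lt h]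
    have h1 : HasDerivAt (fun w => stdCDF z * millsRatio (-w))
        (-(stdCDF z * (-w * millsRatio (-w) + 1))) w := by
      refine (((hasDerivAt_millsRatio (-w)).scomp w (hasDerivAt_neg w)).const_mul
        (stdCDF z)).congr_deriv ?_
      simp only [smul_eq_mul]
      ring
    refine h1.congr_of_eventuallyEq ?_
    filter_upwards [Ioi_mem_nhds h] with x hx
    rw [halfLineSol, if_neg (not_le.2 hx)]

lemma intervalIntegrable_of_abs_le {g : ℝ → ℝ} {M : ℝ} (hg : Measurable g) (hM : ∀ x, |g x| ≤ M)
    (a b : ℝ) : IntervalIntegrable g volume a b :=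
  (intervalIntegrable_const (c := M)).mono_fun' hg.aestronglyMeasurable (ae_of_all _ hM)

lemma integral_halfLineSolDeriv (z x y : ℝ) :
    halfLineSol z y - halfLineSol z x = ∫ t in x..y, halfLineSolDeriv z t := by
  refine (MeasureTheory.integral_eq_of_hasDerivAt_off_countable (halfLineSol z) _
    (countable_singleton z) (continuous_halfLineSol z).continuousOn (fun t ht => ?_)
    (intervalIntegrable_of_abs_le (measurable_halfLineSolDeriv z)
      (abs_halfLineSolDeriv_le z) _ _)).symm
  exact hasDerivAt_halfLineSol (by simpa using ht.2)

lemma lipschitzWith_of_integral {f g : ℝ → ℝ} {M : NNReal} (hM : ∀ x, |g x| ≤ M)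
    (hfg : ∀ x y, f y - f x = ∫ t in x..y, g t) : LipschitzWith M f := by
  refine LipschitzWith.of_dist_le_mul fun x y => ?_
  rw [Real.dist_eq, Real.dist_eq, hfg]
  exact intervalIntegral.norm_integral_le_of_norm_le_const (f := g) fun t _ => hM t

/-- Smoothing at a fixed point keeps the Lipschitz constant. -/
lemma exists_contDiff_lipschitzWith_near {f : ℝ → ℝ} {K : NNReal} (hf : LipschitzWith K f)
    {ε : ℝ} (hε : 0 < ε) :
    ∃ g : ℝ → ℝ, ContDiff ℝ (⊤ : ℕ∞) g ∧ LipschitzWith K g ∧ ∀ x, |g x - f x| ≤ ε := by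
  -- the radius `ε / (K + 1)` also covers `K = 0`
  have hK : (0 : ℝ) < K + 1 := by positivity
  have hr : 0 < ε / (K + 1) := by positivity
  let b : ContDiffBump (0 : ℝ) := ⟨ε / (K + 1) / 2, ε / (K + 1), by positivity, by linarith⟩
  have hcs : HasCompactSupport (b.normed volume) := b.hasCompactSupport_normed
  have hint : ∀ x, Integrable (fun t => b.normed volume t * f (x - t)) := fun x =>
    Continuous.integrable_of_hasCompactSupport
      (b.continuous_normed.mul (hf.continuous.comp (by fun_prop))) hcs.mul_right
  refine ⟨convolution (b.normed volume) f (ContinuousLinearMap.lsmul ℝ ℝ) volume, ?_, ?_, ?_⟩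
  · exact hcs.contDiff_convolution_left _ b.contDiff_normed hf.continuous.locallyIntegrable
  · refine LipschitzWith.of_dist_le_mul fun x y => ?_
    simp only [convolution, ContinuousLinearMap.lsmul_apply, smul_eq_mul]
    rw [dist_eq_norm, ← integral_sub (hint x) (hint y)]
    calc _ ≤ ∫ t, b.normed volume t * (K * dist x y) := by
          refine norm_integral_le_of_norm_le (b.integrable_normed.mul_const _)
            (ae_of_all _ fun t => ?_)
          rw [← mul_sub, norm_mul, Real.norm_of_nonneg (b.nonneg_normed t)]
          refine mul_le_mul_of_nonneg_left ?_ (b.nonneg_normed t)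
          simpa [Real.dist_eq] using hf.dist_le_mul (x - t) (y - t)
      _ = K * dist x y := by rw [integral_mul_const, b.integral_normed, one_mul]
  · intro x
    refine ContDiffBump.dist_normed_convolution_le hf.continuous.aestronglyMeasurable
      fun y hy => ?_
    have h1 : dist y x ≤ ε / (K + 1) := (Metric.mem_ball.1 hy).le
    calc dist (f y) (f x) ≤ K * dist y x := hf.dist_le_mul y x
      _ ≤ (K + 1) * (ε / (K + 1)) := by gcongr; linarith
      _ = ε := by field_simp

/-! ### The coupling identity for Lipschitz functions -/

lemma MeasureTheory.MemLp.integrable_mul_comp_lipschitzWith {Ω : Type*} [MeasurableSpace Ω]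
    {P : Measure Ω} [IsFiniteMeasure P] {W : Ω → ℝ} (hW2 : MemLp W 2 P) {f : ℝ → ℝ} {K : NNReal}
    (hf : LipschitzWith K f) : Integrable (fun ω => W ω * f (W ω)) P := by
  refine ((hW2.integrable_sq.const_mul K).add
    ((hW2.integrable one_le_two).abs.mul_const |f 0|)).mono'
    (hW2.1.mul (hf.continuous.comp_aestronglyMeasurable hW2.1)) (ae_of_all _ fun ω => ?_)
  have h1 := hf.dist_le_mul (W ω) 0
  rw [Real.dist_eq, Real.dist_eq, sub_zero] at h1
  have h2 := abs_add_le (f (W ω) - f 0) (f 0)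
  rw [sub_add_cancel] at h2
  rw [norm_mul, Real.norm_eq_abs, Real.norm_eq_abs, Pi.add_apply, ← sq_abs (W ω)]
  nlinarith [abs_nonneg (W ω)]

/-- A zbest coupling with `G (W'' - W')` integrable satisfies its identity for all Lipschitz
functions: these are uniform limits of smooth functions with the same Lipschitz constant. -/
lemma IsZbest.integral_eq_of_lipschitzWith {Ω : Type*} [MeasurableSpace Ω] {P : Measure Ω}
    [IsProbabilityMeasure P] {W W'' W' G : Ω → ℝ} (hz : IsZbest P W P W'' W' G)
    (hmean : ∫ ω, W ω ∂P = 0) (hW2 : MemLp W 2 P) (hW'' : Measurable W'') (hW' : Measurable W')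
    (hG : Measurable G) (hGD : Integrable (fun ω => G ω * (W'' ω - W' ω)) P)
    {f : ℝ → ℝ} {K : NNReal} (hf : LipschitzWith K f) :
    ∫ ω, W ω * f (W ω) ∂P = ∫ ω, G ω * (f (W'' ω) - f (W' ω)) ∂P := by
  have hWi : Integrable W P := hW2.integrable one_le_two
  have hbd : ∀ {g : ℝ → ℝ}, LipschitzWith K g → ∀ ω,
      ‖G ω * (g (W'' ω) - g (W' ω))‖ ≤ K * ‖G ω * (W'' ω - W' ω)‖ := by
    intro g hg ω
    have := hg.dist_le_mul (W'' ω) (W' ω)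
    rw [Real.dist_eq, Real.dist_eq] at this
    rw [norm_mul, norm_mul, Real.norm_eq_abs, Real.norm_eq_abs, Real.norm_eq_abs]
    calc _ ≤ |G ω| * (K * |W'' ω - W' ω|) := by gcongr
      _ = _ := by ring
  have hmeas : ∀ {g : ℝ → ℝ}, LipschitzWith K g →
      AEStronglyMeasurable (fun ω => G ω * (g (W'' ω) - g (W' ω))) P := fun hg =>
    (hG.mul ((hg.continuous.measurable.comp hW'').sub
      (hg.continuous.measurable.comp hW'))).aestronglyMeasurable
  have hpos : ∀ n : ℕ, (0 : ℝ) < 1 / (n + 1) := fun n => by positivity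
  choose F hFs hFl hFn using fun n : ℕ => exists_contDiff_lipschitzWith_near hf (hpos n)
  have hlim : ∀ x, Tendsto (fun n => F n x) atTop (𝓝 (f x)) := by
    intro x
    rw [tendsto_iff_dist_tendsto_zero]
    exact squeeze_zero (fun _ => dist_nonneg) (fun n => hFn n x)
      tendsto_one_div_add_atTop_nhds_zero_nat
  have hid : ∀ n, ∫ ω, W ω * F n (W ω) ∂P = ∫ ω, G ω * (F n (W'' ω) - F n (W' ω)) ∂P := by
    intro n
    have := hz.identity (F n) (hFs n)
    simp only [hmean, sub_zero] at this
    exact this (hW2.integrable_mul_comp_lipschitzWith (hFl n))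
      ((hGD.norm.const_mul K).mono' (hmeas (hFl n)) (ae_of_all _ (hbd (hFl n))))
  have hL : Tendsto (fun n => ∫ ω, W ω * F n (W ω) ∂P) atTop (𝓝 (∫ ω, W ω * f (W ω) ∂P)) := by
    refine tendsto_integral_of_dominated_convergence (fun ω => ‖W ω * f (W ω)‖ + ‖W ω‖)
      (fun n => hW2.1.mul ((hFl n).continuous.comp_aestronglyMeasurable hW2.1))
      ((hW2.integrable_mul_comp_lipschitzWith hf).norm.add hWi.norm)
      (fun n => ae_of_all _ fun ω => ?_) (ae_of_all _ fun ω => (hlim (W ω)).const_mul _)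
    have h1 : |F n (W ω) - f (W ω)| ≤ 1 := by
      refine (hFn n _).trans ?_
      rw [div_le_one (by positivity)]
      have : (0 : ℝ) ≤ n := n.cast_nonneg
      linarith
    have h2 := norm_add_le (W ω * f (W ω)) (W ω * (F n (W ω) - f (W ω)))
    rw [show W ω * f (W ω) + W ω * (F n (W ω) - f (W ω)) = W ω * F n (W ω) by ring,
      norm_mul (W ω) (F n (W ω) - f (W ω)), Real.norm_eq_abs (F n (W ω) - f (W ω))] at h2
    exact h2.trans (add_le_add le_rfl (mul_le_of_le_one_right (norm_nonneg _) h1))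
  have hR : Tendsto (fun n => ∫ ω, G ω * (F n (W'' ω) - F n (W' ω)) ∂P) atTop
      (𝓝 (∫ ω, G ω * (f (W'' ω) - f (W' ω)) ∂P)) :=
    tendsto_integral_of_dominated_convergence (fun ω => K * ‖G ω * (W'' ω - W' ω)‖)
      (fun n => hmeas (hFl n)) (hGD.norm.const_mul K)
      (fun n => ae_of_all _ (hbd (hFl n)))
      (ae_of_all _ fun ω => ((hlim (W'' ω)).sub (hlim (W' ω))).const_mul _)
  exact tendsto_nhds_unique hL (by simpa only [hid] using hR)

/-- The mean value formula `f x - f y = (x - y) ∫ g(u x + (1 - u) y) du` over `[0, 1]`, averaged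
over the coupling: `U` plays the role of the integration variable `u`. -/
lemma integral_mul_sub_eq_integral_mul_uniform {Ω : Type*} [MeasurableSpace Ω] {P : Measure Ω}
    [IsProbabilityMeasure P] {W'' W' G U : Ω → ℝ} (hW'' : Measurable W'') (hW' : Measurable W')
    (hG : Measurable G) (hU : Measurable U)
    (hUunif : P.map U = volume.restrict (Icc (0 : ℝ) 1))
    (hindep : IndepFun U (fun ω => (W'' ω, W' ω, G ω)) P)
    (hGD : Integrable (fun ω => G ω * (W'' ω - W' ω)) P)
    {f g : ℝ → ℝ} {M : ℝ} (hg : Measurable g) (hM : ∀ x, |g x| ≤ M)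
    (hfg : ∀ x y, f y - f x = ∫ t in x..y, g t) :
    ∫ ω, G ω * (f (W'' ω) - f (W' ω)) ∂P
      = ∫ ω, G ω * (W'' ω - W' ω) * g (U ω * W'' ω + (1 - U ω) * W' ω) ∂P := by
  set V : Ω → ℝ × ℝ × ℝ := fun ω => (W'' ω, W' ω, G ω) with hV
  have hVm : Measurable V := hW''.prodMk (hW'.prodMk hG)
  let H : ℝ × (ℝ × ℝ × ℝ) → ℝ :=
    fun q => q.2.2.2 * (q.2.1 - q.2.2.1) * g (q.1 * q.2.1 + (1 - q.1) * q.2.2.1)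
  have hH : Measurable H := by
    refine Measurable.mul (by fun_prop) (hg.comp (by fun_prop))
  have hHi : Integrable (fun ω => H (U ω, V ω)) P := by
    refine (hGD.norm.mul_const M).mono' (hH.comp (hU.prodMk hVm)).aestronglyMeasurable
      (ae_of_all _ fun ω => ?_)
    simp only [H, hV]
    rw [norm_mul]
    exact mul_le_mul_of_nonneg_left (hM _) (norm_nonneg _)
  have hprod := (indepFun_iff_map_prod_eq_prod_map_map hU.aemeasurable hVm.aemeasurable).1 hindep
  have := Measure.isProbabilityMeasure_map (μ := P) hU.aemeasurable
  have := Measure.isProbabilityMeasure_map (μ := P) hVm.aemeasurable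
  have hHi2 : Integrable H ((P.map U).prod (P.map V)) := by
    rw [← hprod, integrable_map_measure hH.aestronglyMeasurable (hU.prodMk hVm).aemeasurable]
    exact hHi
  have hinner : ∀ v : ℝ × ℝ × ℝ, ∫ u, H (u, v) ∂(P.map U) = v.2.2 * (f v.1 - f v.2.1) := by
    rintro ⟨x, y, c⟩
    rw [hUunif, integral_Icc_eq_integral_Ioc, ← intervalIntegral.integral_of_le zero_le_one, hfg]
    have h1 := intervalIntegral.smul_integral_comp_mul_add (a := 0) (b := 1) g (x - y) y
    simp only [smul_eq_mul, mul_zero, zero_add, mul_one, sub_add_cancel] at h1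
    simp only [H]
    rw [← h1, ← mul_assoc, ← intervalIntegral.integral_const_mul]
    refine intervalIntegral.integral_congr fun u _ => ?_
    congr 2
    ring
  calc ∫ ω, G ω * (f (W'' ω) - f (W' ω)) ∂P
      = ∫ ω, (fun v => ∫ u, H (u, v) ∂(P.map U)) (V ω) ∂P := by simp only [hinner, hV]
    _ = ∫ v, ∫ u, H (u, v) ∂(P.map U) ∂(P.map V) := by
        rw [integral_map hVm.aemeasurable]
        exact hH.stronglyMeasurable.integral_prod_left'.aestronglyMeasurable
    _ = ∫ q, H q ∂((P.map U).prod (P.map V)) := (integral_prod_symm H hHi2).symm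
    _ = ∫ ω, H (U ω, V ω) ∂P := by
        rw [← hprod, integral_map (hU.prodMk hVm).aemeasurable hH.aestronglyMeasurable]
    _ = _ := rfl

/-! ### From the coupling to the two distances -/

lemma abs_integral_sub_le_of_abs_sub_le {μ : Measure ℝ} [IsProbabilityMeasure μ] {f g : ℝ → ℝ}
    (hf : Integrable f μ) (hg : Integrable g μ) {ε : ℝ} (h : ∀ x, |f x - g x| ≤ ε) :
    |∫ x, f x ∂μ - ∫ x, g x ∂μ| ≤ ε := by
  rw [← integral_sub hf hg]
  simpa using norm_integral_le_of_norm_le_const (μ := μ) (f := fun x => f x - g x) (ae_of_all _ h)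

/-- In the Wasserstein distance it suffices to consider smooth test functions. -/
lemma wassersteinDist_le_of_contDiff {μ ν : Measure ℝ} [IsProbabilityMeasure μ]
    [IsProbabilityMeasure ν] (hμ : Integrable (fun x : ℝ => x) μ)
    (hν : Integrable (fun x : ℝ => x) ν) {C : ℝ}
    (hC : ∀ h : ℝ → ℝ, ContDiff ℝ (⊤ : ℕ∞) h → LipschitzWith 1 h →
      |∫ x, h x ∂μ - ∫ x, h x ∂ν| ≤ C) :
    wassersteinDist μ ν ≤ ENNReal.ofReal C := by
  refine iSup₂_le fun h hh => ENNReal.ofReal_le_ofReal ?_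
  have hh : LipschitzWith 1 h := hh
  refine le_of_forall_pos_le_add fun ε hε => ?_
  obtain ⟨g, hgs, hgl, hgh⟩ := exists_contDiff_lipschitzWith_near hh (half_pos hε)
  have h1 := abs_integral_sub_le_of_abs_sub_le (hgl.integrable_of_integrable_id hμ)
    (hh.integrable_of_integrable_id hμ) hgh
  have h2 := abs_integral_sub_le_of_abs_sub_le (hgl.integrable_of_integrable_id hν)
    (hh.integrable_of_integrable_id hν) hgh
  have h3 := hC g hgs hgl
  rw [abs_le] at *
  constructor <;> linarith

lemma lintegral_ofReal_abs_eq {Ω : Type*} [MeasurableSpace Ω] {P : Measure Ω} {X : Ω → ℝ}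
    (hX : Integrable X P) :
    ∫⁻ ω, ENNReal.ofReal |X ω| ∂P = ENNReal.ofReal (∫ ω, |X ω| ∂P) :=
  (ofReal_integral_eq_lintegral_ofReal hX.abs (ae_of_all _ fun _ => abs_nonneg _)).symm

lemma integrable_of_lintegral_ofReal_abs_ne_top {Ω : Type*} [MeasurableSpace Ω] {P : Measure Ω}
    {X : Ω → ℝ} (hX : Measurable X) (h : ∫⁻ ω, ENNReal.ofReal |X ω| ∂P ≠ ∞) : Integrable X P := by
  refine ⟨hX.aestronglyMeasurable, ?_⟩
  rw [hasFiniteIntegral_iff_norm]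
  exact lt_top_iff_ne_top.2 h

lemma abs_integral_mul_le {Ω : Type*} [MeasurableSpace Ω] {P : Measure Ω} {X Y : Ω → ℝ} {M : ℝ}
    (hX : Integrable X P) (hY : ∀ ω, |Y ω| ≤ M) :
    |∫ ω, X ω * Y ω ∂P| ≤ M * ∫ ω, |X ω| ∂P := by
  rw [← integral_const_mul]
  refine norm_integral_le_of_norm_le (f := fun ω => X ω * Y ω) (hX.abs.const_mul M)
    (ae_of_all _ fun ω => ?_)
  rw [norm_mul, mul_comm]
  exact mul_le_mul_of_nonneg_right (hY ω) (norm_nonneg _)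

lemma stdCDF_sub_le {x y : ℝ} (h : x ≤ y) : stdCDF y - stdCDF x ≤ stdPDF 0 * (y - x) := by
  have := Convex.norm_image_sub_le_of_norm_hasDerivWithin_le (s := univ) (C := stdPDF 0)
    (fun x _ => (hasDerivAt_stdCDF x).hasDerivWithinAt)
    (fun x _ => by rw [Real.norm_of_nonneg (stdPDF_pos x).le]; exact stdPDF_le x)
    convex_univ (mem_univ x) (mem_univ y)
  rw [Real.norm_eq_abs, Real.norm_eq_abs, abs_of_nonneg (sub_nonneg.2 h)] at this
  exact (le_abs_self _).trans this

section Coupling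

variable {Ω : Type*} [MeasurableSpace Ω] {P : Measure Ω} [IsProbabilityMeasure P]
  {W X T : Ω → ℝ}

/-- The Wasserstein bound for one smooth test function, with `X` in the role of `W*` and `T` in the
role of `G D`. -/
lemma abs_integral_sub_gaussian_le_of_contDiff (hWm : Measurable W) (hX : Measurable X)
    (hW2 : MemLp W 2 P) (hT : Integrable T P)
    (hXW : Integrable (fun ω => X ω - W ω) P)
    (hstein : ∀ (f g : ℝ → ℝ) (M : NNReal), Measurable g → (∀ x, |g x| ≤ M) →
      (∀ x y, f y - f x = ∫ t in x..y, g t) →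
      ∫ ω, W ω * f (W ω) ∂P = ∫ ω, T ω * g (X ω) ∂P)
    {h : ℝ → ℝ} (hs : ContDiff ℝ (⊤ : ℕ∞) h) (hl : LipschitzWith 1 h) :
    |∫ x, h x ∂(P.map W) - ∫ x, h x ∂gaussianReal 0 1|
      ≤ 2 * (∫ ω, |X ω - W ω| ∂P) + √(2 / Real.pi) * ∫ ω, |1 - T ω| ∂P := by
  have hd : Differentiable ℝ h := hs.differentiable (by simp)
  have hp : Continuous (deriv h) := hs.continuous_deriv (by simp)
  have hp1 : ∀ x, |deriv h x| ≤ 1 := fun x => by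
    simpa using norm_deriv_le_of_lipschitz (x₀ := x) hl
  set c := ∫ x, h x ∂gaussianReal 0 1
  set f := steinSol (deriv h)
  set g := steinSolDeriv (deriv h)
  have heq : ∀ w, g w - w * f w = h w - c :=
    steinSol_equation hp hp1 fun x => (hd x).hasDerivAt
  have hgc : Continuous g := continuous_steinSolDeriv hp hp1
  have hgM : ∀ x, |g x| ≤ √(2 / Real.pi) := abs_steinSolDeriv_le hp1
  have hfg : ∀ x y, f y - f x = ∫ t in x..y, g t := fun x y =>
    (intervalIntegral.integral_eq_sub_of_hasDerivAt (fun t _ => hasDerivAt_steinSol hp hp1 t)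
      (hgc.intervalIntegrable _ _)).symm
  let M : NNReal := ⟨√(2 / Real.pi), Real.sqrt_nonneg _⟩
  have hst := hstein f g M hgc.measurable hgM hfg
  have hWf : Integrable (fun ω => W ω * f (W ω)) P :=
    hW2.integrable_mul_comp_lipschitzWith (lipschitzWith_of_integral (M := M) hgM hfg)
  have hbdd : ∀ Y : Ω → ℝ, Measurable Y → Integrable (fun ω => g (Y ω)) P := fun Y hY =>
    (integrable_const √(2 / Real.pi)).mono' (hgc.measurable.comp hY).aestronglyMeasurable
      (ae_of_all _ fun ω => hgM _)
  have hTg : Integrable (fun ω => T ω * g (X ω)) P :=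
    hT.mul_bdd (c := √(2 / Real.pi)) (hgc.measurable.comp hX).aestronglyMeasurable
      (ae_of_all _ fun ω => hgM _)
  have hT1 : Integrable (fun ω => 1 - T ω) P := (integrable_const 1).sub hT
  have hdiff : ∫ x, h x ∂(P.map W) - c
      = (∫ ω, (g (W ω) - g (X ω)) ∂P) + ∫ ω, (1 - T ω) * g (X ω) ∂P := by
    have h1 : ∫ ω, (1 - T ω) * g (X ω) ∂P = ∫ ω, g (X ω) ∂P - ∫ ω, W ω * f (W ω) ∂P := by
      rw [hst, ← integral_sub (hbdd X hX) hTg]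
      congr 1; ext ω; ring
    have hh : Integrable (fun ω => h (W ω)) P := by
      have : (fun ω => h (W ω)) = fun ω => g (W ω) - W ω * f (W ω) + c := by
        ext ω; linarith [heq (W ω)]
      rw [this]
      exact ((hbdd W hWm).sub hWf).add (integrable_const c)
    have h2 : ∫ ω, h (W ω) ∂P - c = ∫ ω, g (W ω) ∂P - ∫ ω, W ω * f (W ω) ∂P := by
      rw [← integral_sub (hbdd W hWm) hWf]
      simp_rw [heq]
      rw [integral_sub hh (integrable_const c)]
      simp
    rw [integral_map hWm.aemeasurable hl.continuous.aestronglyMeasurable, h2, h1,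
      integral_sub (hbdd W hWm) (hbdd X hX)]
    ring
  rw [hdiff]
  refine (abs_add_le _ _).trans (add_le_add ?_ (abs_integral_mul_le hT1 fun ω => hgM _))
  rw [← integral_const_mul]
  refine norm_integral_le_of_norm_le (f := fun ω => g (W ω) - g (X ω)) (hXW.abs.const_mul 2)
    (ae_of_all _ fun ω => ?_)
  rw [abs_sub_comm]
  exact lipschitz_steinSolDeriv hp hp1 _ _

/-- Stein's equation for a half line bounds the distance of `X`, in the role of `W*`, from the
normal law: `x f(x)` changes by at most `(|W| + √(2π) / 4) δ` between `W` and `X`. -/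
lemma abs_measure_le_sub_stdCDF_le (hX : Measurable X) (hW2 : MemLp W 2 P)
    (hW1 : ∫ ω, |W ω| ∂P ≤ 1) (hT : Integrable T P) {δ : ℝ} (hδ : 0 ≤ δ)
    (hXW : ∀ᵐ ω ∂P, |X ω - W ω| ≤ δ)
    (hstein : ∀ (f g : ℝ → ℝ) (M : NNReal), Measurable g → (∀ x, |g x| ≤ M) →
      (∀ x y, f y - f x = ∫ t in x..y, g t) →
      ∫ ω, W ω * f (W ω) ∂P = ∫ ω, T ω * g (X ω) ∂P) (z : ℝ) :
    |P.real {ω | X ω ≤ z} - stdCDF z|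
      ≤ (√(2 * Real.pi) / 4 + 1) * δ + ∫ ω, |1 - T ω| ∂P := by
  set c := √(2 * Real.pi) / 4
  set f := halfLineSol z
  set g := halfLineSolDeriv z
  have hfc : Continuous f := continuous_halfLineSol z
  have hfb : ∀ x, |f x| ≤ c := abs_halfLineSol_le z
  have hgm : Measurable g := measurable_halfLineSolDeriv z
  have hgM : ∀ x, |g x| ≤ ((1 : NNReal) : ℝ) := by simpa using abs_halfLineSolDeriv_le z
  have hfg : ∀ x y, f y - f x = ∫ t in x..y, g t := integral_halfLineSolDeriv z
  have hfl : LipschitzWith 1 f := lipschitzWith_of_integral hgM hfg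
  have hst := hstein f g 1 hgm hgM hfg
  have hWi : Integrable W P := hW2.integrable one_le_two
  have hXi : Integrable X P := by
    refine (hWi.abs.add (integrable_const δ)).mono' hX.aestronglyMeasurable ?_
    filter_upwards [hXW] with ω hω
    have := abs_add_le (X ω - W ω) (W ω)
    rw [sub_add_cancel] at this
    rw [Real.norm_eq_abs, Pi.add_apply]
    linarith
  have hWf : Integrable (fun ω => W ω * f (W ω)) P := hW2.integrable_mul_comp_lipschitzWith hfl
  have hXf : Integrable (fun ω => X ω * f (X ω)) P :=
    hXi.mul_bdd (c := c) (hfc.measurable.comp hX).aestronglyMeasurable (ae_of_all _ fun ω => hfb _)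
  have hgX : Integrable (fun ω => g (X ω)) P :=
    (integrable_const ((1 : NNReal) : ℝ)).mono' (hgm.comp hX).aestronglyMeasurable
      (ae_of_all _ fun ω => hgM _)
  have hTg : Integrable (fun ω => T ω * g (X ω)) P :=
    hT.mul_bdd (c := ((1 : NNReal) : ℝ)) (hgm.comp hX).aestronglyMeasurable
      (ae_of_all _ fun ω => hgM _)
  have hT1 : Integrable (fun ω => 1 - T ω) P := (integrable_const 1).sub hT
  have hset : MeasurableSet {ω | X ω ≤ z} := hX measurableSet_Iic
  have hprob : P.real {ω | X ω ≤ z} - stdCDF z = ∫ ω, g (X ω) ∂P - ∫ ω, X ω * f (X ω) ∂P := by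
    have h1 : ∀ ω, g (X ω) - X ω * f (X ω)
        = {ω | X ω ≤ z}.indicator (fun _ => (1 : ℝ)) ω - stdCDF z := by
      intro ω
      have : (Iic z).indicator (fun _ => (1 : ℝ)) (X ω)
          = {ω | X ω ≤ z}.indicator (fun _ => (1 : ℝ)) ω := rfl
      rw [← this]
      simp only [g, halfLineSolDeriv, f]
      ring
    rw [← integral_sub hgX hXf]
    simp_rw [h1]
    rw [integral_sub ((integrable_const 1).indicator hset) (integrable_const _),
      integral_indicator hset]
    simp
  have hdecomp : P.real {ω | X ω ≤ z} - stdCDF z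
      = (∫ ω, (W ω * f (W ω) - X ω * f (X ω)) ∂P) + ∫ ω, (1 - T ω) * g (X ω) ∂P := by
    have h1 : ∫ ω, (1 - T ω) * g (X ω) ∂P = ∫ ω, g (X ω) ∂P - ∫ ω, W ω * f (W ω) ∂P := by
      rw [hst, ← integral_sub hgX hTg]
      congr 1; ext ω; ring
    rw [hprob, h1, integral_sub hWf hXf]
    ring
  have hmain : |∫ ω, (W ω * f (W ω) - X ω * f (X ω)) ∂P| ≤ (c + 1) * δ := by
    have hint : Integrable (fun ω => (|W ω| + c) * δ) P :=
      (hWi.abs.add (integrable_const c)).mul_const δ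
    have hle : |∫ ω, (W ω * f (W ω) - X ω * f (X ω)) ∂P| ≤ ∫ ω, (|W ω| + c) * δ ∂P := by
      refine norm_integral_le_of_norm_le (f := fun ω => W ω * f (W ω) - X ω * f (X ω)) hint ?_
      filter_upwards [hXW] with ω hω
      have h1 : |f (W ω) - f (X ω)| ≤ δ := by
        have := hfl.dist_le_mul (W ω) (X ω)
        rw [Real.dist_eq, Real.dist_eq, NNReal.coe_one, one_mul, abs_sub_comm (W ω)] at this
        exact this.trans hω
      rw [show W ω * f (W ω) - X ω * f (X ω)
        = W ω * (f (W ω) - f (X ω)) - (X ω - W ω) * f (X ω) by ring]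
      refine (abs_sub _ _).trans ?_
      rw [abs_mul, abs_mul]
      have h2 := mul_le_mul_of_nonneg_left h1 (abs_nonneg (W ω))
      have h3 := mul_le_mul hω (hfb (X ω)) (abs_nonneg _) hδ
      linarith
    refine hle.trans ?_
    rw [integral_mul_const, integral_add hWi.abs (integrable_const c)]
    refine mul_le_mul_of_nonneg_right ?_ hδ
    simp only [integral_const, probReal_univ, one_smul]
    linarith
  rw [hdecomp]
  refine (abs_add_le _ _).trans (add_le_add hmain ?_)
  simpa using abs_integral_mul_le hT1 fun ω => hgM (X ω)

/-- Comparing `{W ≤ z}` with `{X ≤ z ± δ}` transfers the estimate from `X` to `W`. -/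
lemma kolmogorovDist_gaussian_le (hWm : Measurable W) {δ C : ℝ} (hδ : 0 ≤ δ)
    (hXW : ∀ᵐ ω ∂P, |X ω - W ω| ≤ δ)
    (hC : ∀ z, |P.real {ω | X ω ≤ z} - stdCDF z| ≤ C) :
    kolmogorovDist (P.map W) (gaussianReal 0 1) ≤ ENNReal.ofReal (stdPDF 0 * δ + C) := by
  refine iSup₂_le fun h hh => ENNReal.ofReal_le_ofReal ?_
  obtain ⟨z, rfl⟩ := hh
  have h1 : ∫ x, (Iic z).indicator (fun _ => (1 : ℝ)) x ∂(P.map W) = P.real {ω | W ω ≤ z} := by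
    rw [integral_indicator measurableSet_Iic]
    simp only [integral_const, smul_eq_mul, mul_one, measureReal_restrict_apply_univ]
    rw [map_measureReal_apply hWm measurableSet_Iic]
    rfl
  have h2 : ∫ x, (Iic z).indicator (fun _ => (1 : ℝ)) x ∂(gaussianReal 0 1) = stdCDF z := by
    rw [integral_indicator measurableSet_Iic, stdCDF, cdf_eq_real]
    simp
  rw [h1, h2]
  have hup : P.real {ω | W ω ≤ z} ≤ P.real {ω | X ω ≤ z + δ} := by
    refine ENNReal.toReal_mono (measure_ne_top _ _) (measure_mono_ae ?_)
    filter_upwards [hXW] with ω hω (hωz : W ω ≤ z)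
    exact show X ω ≤ z + δ by linarith [(abs_le.1 hω).2]
  have hlo : P.real {ω | X ω ≤ z - δ} ≤ P.real {ω | W ω ≤ z} := by
    refine ENNReal.toReal_mono (measure_ne_top _ _) (measure_mono_ae ?_)
    filter_upwards [hXW] with ω hω (hωz : X ω ≤ z - δ)
    exact show W ω ≤ z by linarith [(abs_le.1 hω).1]
  have h3 := stdCDF_sub_le (show z ≤ z + δ by linarith)
  have h4 := stdCDF_sub_le (show z - δ ≤ z by linarith)
  rw [add_sub_cancel_left] at h3
  rw [sub_sub_cancel] at h4
  have h5 := abs_le.1 (hC (z + δ))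
  have h6 := abs_le.1 (hC (z - δ))
  rw [abs_le]
  constructor <;> linarith

end Coupling

lemma integral_abs_le_one_of_variance_eq_one {Ω : Type*} [MeasurableSpace Ω] {P : Measure Ω}
    [IsProbabilityMeasure P] {W : Ω → ℝ} (hW2 : MemLp W 2 P) (hmean : ∫ ω, W ω ∂P = 0)
    (hvar : variance W P = 1) : ∫ ω, |W ω| ∂P ≤ 1 := by
  rw [variance_of_integral_eq_zero hW2.1.aemeasurable hmean] at hvar
  calc ∫ ω, |W ω| ∂P ≤ ∫ ω, (W ω ^ 2 + 1) / 2 ∂P := by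
        refine integral_mono (hW2.integrable one_le_two).abs
          ((hW2.integrable_sq.add (integrable_const 1)).div_const 2) fun ω => ?_
        have := sq_nonneg (|W ω| - 1)
        rw [← sq_abs (W ω)]
        dsimp only
        nlinarith
    _ = 1 := by
        rw [integral_div, integral_add hW2.integrable_sq (integrable_const 1), hvar]
        simp

lemma kolmogorov_constant_lt :
    1 / √(2 * Real.pi) + √(2 * Real.pi) / 4 + 1 < 2.03 := by
  have h1 : 2.505 < √(2 * Real.pi) := by
    rw [Real.lt_sqrt (by norm_num)]
    linarith [Real.pi_gt_d2]
  have h2 : √(2 * Real.pi) < 2.51 := by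
    rw [Real.sqrt_lt' (by norm_num)]
    linarith [Real.pi_lt_d2]
  have h3 : 1 / √(2 * Real.pi) < 1 / 2.505 := one_div_lt_one_div_of_lt (by norm_num) h1
  have h4 : (1 : ℝ) / 2.505 < 0.4 := by norm_num
  linarith

theorem mainTheorem2 {Ω : Type*} [MeasurableSpace Ω] (P : Measure Ω) [IsProbabilityMeasure P]
    (W W'' W' G U Wstar D : Ω → ℝ)
    (hW : Measurable W) (hW'' : Measurable W'') (hW' : Measurable W') (hG : Measurable G)
    (hU : Measurable U)
    (hmean : ∫ ω, W ω ∂P = 0) (hvar : variance W P = 1)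
    (hzbest : IsZbest P W P W'' W' G)
    (hUunif : P.map U = volume.restrict (Set.Icc (0 : ℝ) 1))
    (hindep : IndepFun U (fun ω => (W'' ω, W' ω, G ω)) P)
    (hWstar : ∀ ω, Wstar ω = U ω * W'' ω + (1 - U ω) * W' ω)
    (hD : ∀ ω, D ω = W'' ω - W' ω) :
    wassersteinDist (P.map W) (gaussianReal 0 1)
        ≤ 2 * ∫⁻ ω, ENNReal.ofReal |Wstar ω - W ω| ∂P
          + ENNReal.ofReal (Real.sqrt (2 / Real.pi))
              * ∫⁻ ω, ENNReal.ofReal |1 - G ω * D ω| ∂P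
    ∧ (∀ δ : ℝ, 0 ≤ δ → (∀ᵐ ω ∂P, |Wstar ω - W ω| ≤ δ) →
        kolmogorovDist (P.map W) (gaussianReal 0 1)
          ≤ ENNReal.ofReal
              ((1 / Real.sqrt (2 * Real.pi) + Real.sqrt (2 * Real.pi) / 4 + 1) * δ)
            + ∫⁻ ω, ENNReal.ofReal |1 - G ω * D ω| ∂P)
    ∧ 1 / Real.sqrt (2 * Real.pi) + Real.sqrt (2 * Real.pi) / 4 + 1 < 2.03 := by
  simp only [hWstar, hD]
  have hX : Measurable fun ω => U ω * W'' ω + (1 - U ω) * W' ω := by fun_prop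
  have hW2 : MemLp W 2 P := by
    -- the variance of a variable without second moment is `0` by convention
    by_contra hcon
    rw [variance_of_not_memLp hW.aestronglyMeasurable hcon] at hvar
    exact zero_ne_one hvar
  have hstein : Integrable (fun ω => G ω * (W'' ω - W' ω)) P →
      ∀ (f g : ℝ → ℝ) (M : NNReal), Measurable g → (∀ x, |g x| ≤ M) →
      (∀ x y, f y - f x = ∫ t in x..y, g t) → ∫ ω, W ω * f (W ω) ∂P
        = ∫ ω, G ω * (W'' ω - W' ω) * g (U ω * W'' ω + (1 - U ω) * W' ω) ∂P := by
    intro hT f g M hg hM hfg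
    rw [hzbest.integral_eq_of_lipschitzWith hmean hW2 hW'' hW' hG hT
      (lipschitzWith_of_integral hM hfg)]
    exact integral_mul_sub_eq_integral_mul_uniform hW'' hW' hG hU hUunif hindep hT hg hM hfg
  have hTint : ∫⁻ ω, ENNReal.ofReal |1 - G ω * (W'' ω - W' ω)| ∂P ≠ ∞ →
      Integrable (fun ω => G ω * (W'' ω - W' ω)) P := by
    intro hne
    have := (integrable_const (1 : ℝ)).sub
      (integrable_of_lintegral_ofReal_abs_ne_top (by fun_prop) hne)
    simpa [Pi.sub_def] using this
  have hmap := Measure.isProbabilityMeasure_map (μ := P) hW.aemeasurable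
  refine ⟨?_, fun δ hδ hXW => ?_, kolmogorov_constant_lt⟩
  · by_cases hB : ∫⁻ ω, ENNReal.ofReal |1 - G ω * (W'' ω - W' ω)| ∂P = ∞
    · have h0 : ENNReal.ofReal √(2 / Real.pi) ≠ 0 := by
        rw [Ne, ENNReal.ofReal_eq_zero, not_le]
        positivity
      rw [hB, ENNReal.mul_top h0, add_top]
      exact le_top
    by_cases hA : ∫⁻ ω, ENNReal.ofReal |U ω * W'' ω + (1 - U ω) * W' ω - W ω| ∂P = ∞
    · rw [hA, ENNReal.mul_top two_ne_zero, top_add]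
      exact le_top
    have hT := hTint hB
    have hXW : Integrable (fun ω => U ω * W'' ω + (1 - U ω) * W' ω - W ω) P :=
      integrable_of_lintegral_ofReal_abs_ne_top (by fun_prop) hA
    have hT1 : Integrable (fun ω => 1 - G ω * (W'' ω - W' ω)) P := (integrable_const 1).sub hT
    rw [lintegral_ofReal_abs_eq hXW, lintegral_ofReal_abs_eq hT1,
      ← ENNReal.ofReal_mul (Real.sqrt_nonneg _), ← ENNReal.ofReal_ofNat 2,
      ← ENNReal.ofReal_mul zero_le_two,
      ← ENNReal.ofReal_add (by positivity) (by positivity)]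
    refine wassersteinDist_le_of_contDiff ?_ (integrable_id_gaussianReal 0 1) fun h hs hl =>
      abs_integral_sub_gaussian_le_of_contDiff hW hX hW2 hT hXW (hstein hT) hs hl
    exact (integrable_map_measure measurable_id.aestronglyMeasurable hW.aemeasurable).2
      (hW2.integrable one_le_two)
  · by_cases hB : ∫⁻ ω, ENNReal.ofReal |1 - G ω * (W'' ω - W' ω)| ∂P = ∞
    · rw [hB, add_top]
      exact le_top
    have hT := hTint hB
    have hT1 : Integrable (fun ω => 1 - G ω * (W'' ω - W' ω)) P := (integrable_const 1).sub hT
    rw [lintegral_ofReal_abs_eq hT1,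
      ← ENNReal.ofReal_add (by positivity) (by positivity)]
    refine (kolmogorovDist_gaussian_le hW hδ hXW (abs_measure_le_sub_stdCDF_le hX hW2
      (integral_abs_le_one_of_variance_eq_one hW2 hmean hvar) hT hδ hXW (hstein hT))).trans
      (ENNReal.ofReal_le_ofReal (le_of_eq ?_))
    rw [stdPDF_zero]
    ring
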